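/- Let $H$ be a separable complex Hilbert space, $\mathcal B(H)$ the bounded linear operators on $H$, and $\mathcal D\subseteq\mathcal B(H)$ a maximal abelian selfadjoint algebra. For a subspace $\mathcal X\subseteq\mathcal B(H)$ and $T\in\mathcal B(H)$ put $$d(T,\mathcal X)=\inf_{X\in\mathcal X}\|T-X\|,\qquad \alpha(T,\mathcal X)=\sup_{\|\xi\|=1}\ \inf_{X\in\mathcal X}\|T\xi-X\xi\|,$$ and call $\mathcal X$ hyperreflexive if there is $k>0$ with $d(T,\mathcal X)\le k\,\alpha(T,\mathcal X)$ for all $T\in\mathcal B(H)$. A Schur idempotent is a weak* continuous linear $\mathcal D$-bimodule map $\Phi:\mathcal B(H)\to\mathcal B(H)$ with $\Phi\circ\Phi=\Phi$; let $\mathfrak I$ be the set of all Schur idempotents. Let $\mathfrak H$ be the set of $\Phi\in\mathfrak I$ for which there is $\lambda>0$ with $$\|T-\Phi(T)\|\le\lambda\,\alpha(T,\operatorname{ran}\Phi)\qquad\text{for all }T\in\mathcal B(H),$$ and for $\Phi\in\mathfrak H$ let $\lambda(\Phi)$ be the least $\lambda\ge 0$ with this property. Then $\mathfrak H$ is exactly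 the set of Schur idempotents whose range is hyperreflexive. The set $\mathfrak I$, ordered by $\Phi\le\Psi\iff\Phi\Psi=\Phi$ (products being compositions), is a Boolean lattice with $\Phi\wedge\Psi=\Phi\Psi$, $\Phi\vee\Psi=\Phi+\Psi-\Phi\Psi$ and complement $\Phi^\perp=\mathrm{id}-\Phi$, and $\mathfrak H$ is a sublattice of $\mathfrak I$. Moreover, for all $\Phi_1,\Phi_2\in\mathfrak H$, $$\lambda(\Phi_1\Phi_2)\le\lambda(\Phi_1)+\lambda(\Phi_2)\,\|\Phi_1\|,\qquad \lambda(\Phi_1\vee\Phi_2)\le\lambda(\Phi_1)\,\lambda(\Phi_2),$$ where $\|\Phi_1\|$ is the norm of $\Phi_1$ as a linear map on the Banach space $\mathcal B(H)$. -/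

import Mathlib

open scoped InnerProductSpace Topology

namespace SchurHyper

variable {H : Type*} [NormedAddCommGroup H] [InnerProductSpace ℂ H]

/-- The weak* topology of `B(H)`, regarded as the dual of the trace class: the coarsest topology
making every functional `T ↦ ∑ₙ ⟪ηₙ, T ξₙ⟫` continuous, where `∑ ‖ξₙ‖² < ∞` and `∑ ‖ηₙ‖² < ∞`.
These are exactly the functionals given by trace class operators. -/
@[reducible] noncomputable def weakStarTopology (H : Type*) [NormedAddCommGroup H] [InnerProductSpace ℂ H] :
    TopologicalSpace (H →L[ℂ] H) :=
  ⨅ p : {p : (ℕ → H) × (ℕ → H) //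
      (Summable fun n => ‖p.1 n‖ ^ 2) ∧ (Summable fun n => ‖p.2 n‖ ^ 2)},
    TopologicalSpace.induced
      (fun T : H →L[ℂ] H => ∑' n, ⟪p.1.2 n, T (p.1.1 n)⟫_ℂ) inferInstance

/-- A masa: a maximal element among the commutative selfadjoint subalgebras of `B(H)`. -/
def IsMasa [CompleteSpace H] (D : StarSubalgebra ℂ (H →L[ℂ] H)) : Prop :=
  Maximal (fun A : StarSubalgebra ℂ (H →L[ℂ] H) => ∀ a ∈ A, ∀ b ∈ A, a * b = b * a) D

/-- The distance `d(T, X) = inf {‖T - X‖ : X ∈ X}`. -/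
noncomputable def opDist (T : H →L[ℂ] H) (X : Submodule ℂ (H →L[ℂ] H)) : ℝ :=
  ⨅ S : X, ‖T - (S : H →L[ℂ] H)‖

/-- The Arveson distance `α(T, X) = sup {inf {‖T ξ - X ξ‖ : X ∈ X} : ‖ξ‖ = 1}`. -/
noncomputable def arvesonDist (T : H →L[ℂ] H) (X : Submodule ℂ (H →L[ℂ] H)) : ℝ :=
  ⨆ ξ : {ξ : H // ‖ξ‖ = 1}, ⨅ S : X, ‖T (ξ : H) - (S : H →L[ℂ] H) (ξ : H)‖

/-- Hyperreflexive subspaces of `B(H)`. -/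
def IsHyperreflexive (X : Submodule ℂ (H →L[ℂ] H)) : Prop :=
  ∃ k : ℝ, 0 < k ∧ ∀ T : H →L[ℂ] H, opDist T X ≤ k * arvesonDist T X

variable [CompleteSpace H]

/-- Schur multipliers: weak* continuous `D`-bimodule maps on `B(H)`.
(A weak* continuous linear map on `B(H)` is automatically norm bounded.) -/
structure IsSchurMultiplier (D : StarSubalgebra ℂ (H →L[ℂ] H))
    (Φ : (H →L[ℂ] H) →L[ℂ] (H →L[ℂ] H)) : Prop where
  weakStar_continuous : Continuous[weakStarTopology H, weakStarTopology H] Φ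
  map_bimodule : ∀ a ∈ D, ∀ b ∈ D, ∀ T : H →L[ℂ] H, Φ (a * T * b) = a * Φ T * b

/-- The collection of all Schur idempotents, that is, of the Schur multipliers `Φ` such that the
composition `Φ * Φ` equals `Φ`. -/
def SchurIdempotent (D : StarSubalgebra ℂ (H →L[ℂ] H)) : Type _ :=
  {Φ : (H →L[ℂ] H) →L[ℂ] (H →L[ℂ] H) // IsSchurMultiplier D Φ ∧ Φ * Φ = Φ}

namespace SchurIdempotent

variable {D : StarSubalgebra ℂ (H →L[ℂ] H)}

/-- The underlying bounded linear map on `B(H)`. -/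
def map (Φ : SchurIdempotent D) : (H →L[ℂ] H) →L[ℂ] (H →L[ℂ] H) := Φ.1

/-- The range of a Schur idempotent. -/
def ran (Φ : SchurIdempotent D) : Submodule ℂ (H →L[ℂ] H) :=
  LinearMap.range (Φ.map : (H →L[ℂ] H) →ₗ[ℂ] (H →L[ℂ] H))

/-- The estimate `‖T - Φ(T)‖ ≤ c α(T, ran Φ)` for all `T`. -/
def Estimate (Φ : SchurIdempotent D) (c : ℝ) : Prop :=
  ∀ T : H →L[ℂ] H, ‖T - Φ.map T‖ ≤ c * arvesonDist T Φ.ran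

/-- The set of the Schur idempotents that satisfy such an estimate with some `c > 0`. -/
def estimateSet (D : StarSubalgebra ℂ (H →L[ℂ] H)) : Set (SchurIdempotent D) :=
  {Φ | ∃ c : ℝ, 0 < c ∧ Φ.Estimate c}

/-- The constant `λ(Φ)`: the least `c ≥ 0` with `‖T - Φ(T)‖ ≤ c α(T, ran Φ)` for all `T`. -/
noncomputable def estimateConst (Φ : SchurIdempotent D) : ℝ :=
  sInf {c : ℝ | 0 ≤ c ∧ Φ.Estimate c}

/-- On `estimateSet D` the infimum defining the constant is attained. -/
theorem isLeast_estimateConst {Φ : SchurIdempotent D} (h : Φ ∈ estimateSet D) :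
    IsLeast {c : ℝ | 0 ≤ c ∧ Φ.Estimate c} Φ.estimateConst := by
  have hb : BddBelow {c : ℝ | 0 ≤ c ∧ Φ.Estimate c} := ⟨0, fun c hc => hc.1⟩
  have hn : {c : ℝ | 0 ≤ c ∧ Φ.Estimate c}.Nonempty := by
    obtain ⟨c, hc, h⟩ := h
    exact ⟨c, hc.le, h⟩
  have hcl : IsClosed {c : ℝ | 0 ≤ c ∧ Φ.Estimate c} := by
    simp only [Estimate, Set.ofPred_and, Set.ofPred_forall]
    exact (isClosed_le continuous_const continuous_id).inter
      (isClosed_iInter fun T => isClosed_le continuous_const (continuous_id.mul continuous_const))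
  exact ⟨hcl.csInf_mem hn hb, fun c hc => csInf_le hb hc⟩

end SchurIdempotent

end SchurHyper

/-! The order and the lattice laws on Schur idempotents are formal consequences of one fact: Schur
multipliers commute (`IsSchurMultiplier.comm`). Commuting idempotents of a ring form a Boolean
algebra under `e * f`, `e + f - e * f`, `1 - e`. Commutativity is proved without a measure-theoretic
model of the masa. On the cyclic subspace `[D ξ]` the map `a ξ ↦ a* ξ` extends to an antilinear
isometry `J`. Weak* continuity gives `⟪ξ, Φ(T) ξ⟫ = ∑ ⟪yₙ, T xₙ⟫`, and the bimodule property then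
yields `Φ(ξ ⊗ ξ*) = ∑ J yₙ ⊗ (J xₙ)*` (`exists_kernel`). Inserting this expansion for `Ψ` into the
formula for `Φ` gives a double series that is symmetric in `Φ` and `Ψ`, because `⟪J x, b x'⟫ = ⟪J
x', b x⟫` for `b ∈ D`. Finitely many vectors lie in one cyclic subspace, so the maps agree on all
rank one operators, which determine a weak* continuous map. The meet estimate comes from `T -
Φ₁Φ₂(T) = (T - Φ₁(T)) + Φ₁(T - Φ₂(T))`. For the join, `T - Ψ(T) = (id - Φ₁)(S)` with `S = T -
Φ₂(T)`. For a unit vector `ξ`, let `P` and `Q` project onto `[D ξ]` and `[ran Φ₁ ξ]`. Both lie in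
`D`, and `(1 - Q) V P = 0` for `V ∈ ran Φ₁`. Compression by `1 - Q` and `P` thus commutes with `Φ₂`
and carries `ran Ψ` into `ran Φ₂`, so the estimate for `Φ₂` controls the distance from `S ξ` to `ran
Φ₁ ξ`. -/

namespace SchurHyper

variable {H : Type*} [NormedAddCommGroup H] [InnerProductSpace ℂ H]

/-! ### The weak* topology -/

theorem norm_inner_apply_le_sq (T : H →L[ℂ] H) (x y : H) :
    ‖⟪y, T x⟫_ℂ‖ ≤ ‖T‖ * (‖x‖ ^ 2 + ‖y‖ ^ 2) := by
  have h1 : ‖⟪y, T x⟫_ℂ‖ ≤ ‖y‖ * (‖T‖ * ‖x‖) :=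
    (norm_inner_le_norm _ _).trans (by gcongr; exact T.le_opNorm x)
  nlinarith [norm_nonneg T, sq_nonneg (‖x‖ - ‖y‖), sq_nonneg ‖x‖, sq_nonneg ‖y‖,
    mul_nonneg (norm_nonneg T) (sq_nonneg (‖x‖ - ‖y‖)), mul_nonneg (norm_nonneg T) (sq_nonneg ‖x‖),
    mul_nonneg (norm_nonneg T) (sq_nonneg ‖y‖)]

theorem summable_inner_apply {x y : ℕ → H} (hx : Summable fun n => ‖x n‖ ^ 2)
    (hy : Summable fun n => ‖y n‖ ^ 2) (T : H →L[ℂ] H) :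
    Summable fun n => ⟪y n, T (x n)⟫_ℂ :=
  .of_norm_bounded ((hx.add hy).mul_left ‖T‖) fun _ => norm_inner_apply_le_sq _ _ _

theorem summable_norm_mul_norm {E : Type*} [NormedAddCommGroup E] {x y : ℕ → E}
    (hx : Summable fun n => ‖x n‖ ^ 2)
    (hy : Summable fun n => ‖y n‖ ^ 2) : Summable fun n => ‖y n‖ * ‖x n‖ :=
  .of_nonneg_of_le (fun _ => by positivity)
    (fun n => by nlinarith [sq_nonneg (‖x n‖ - ‖y n‖), sq_nonneg ‖x n‖, sq_nonneg ‖y n‖])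
    (hx.add hy)

/-- The functional `T ↦ ∑ₙ ⟪yₙ, T xₙ⟫` on `B(H)`. -/
noncomputable def traceFunctional (p : {p : (ℕ → H) × (ℕ → H) //
    (Summable fun n => ‖p.1 n‖ ^ 2) ∧ (Summable fun n => ‖p.2 n‖ ^ 2)}) :
    (H →L[ℂ] H) →ₗ[ℂ] ℂ where
  toFun T := ∑' n, ⟪p.1.2 n, T (p.1.1 n)⟫_ℂ
  map_add' S T := by
    simp only [add_apply, inner_add_right]
    exact (summable_inner_apply p.2.1 p.2.2 S).tsum_add (summable_inner_apply p.2.1 p.2.2 T)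
  map_smul' c T := by
    simp only [smul_apply, inner_smul_right, tsum_mul_left, RingHom.id_apply,
      smul_eq_mul]

theorem weakStarTopology_eq : weakStarTopology H =
    ⨅ p, TopologicalSpace.induced (traceFunctional (H := H) p) inferInstance := rfl

theorem continuous_traceFunctional (p) :
    Continuous[weakStarTopology H, inferInstance] (traceFunctional (H := H) p) :=
  continuous_iInf_dom (i := p) continuous_induced_dom

theorem weakStar_continuous_iff {Φ : (H →L[ℂ] H) →L[ℂ] (H →L[ℂ] H)} :
    Continuous[weakStarTopology H, weakStarTopology H] Φ ↔
      ∀ p, Continuous[weakStarTopology H, inferInstance] fun T => traceFunctional p (Φ T) := by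
  rw [weakStarTopology_eq]
  simp only [continuous_iInf_rng, continuous_induced_rng]
  rfl

theorem weakStar_continuous_add {Φ Ψ : (H →L[ℂ] H) →L[ℂ] (H →L[ℂ] H)}
    (hΦ : Continuous[weakStarTopology H, weakStarTopology H] Φ)
    (hΨ : Continuous[weakStarTopology H, weakStarTopology H] Ψ) :
    Continuous[weakStarTopology H, weakStarTopology H] ⇑(Φ + Ψ) := by
  rw [weakStar_continuous_iff] at *
  intro p
  let _ := weakStarTopology H
  simp only [add_apply, map_add]
  exact (hΦ p).add (hΨ p)

theorem weakStar_continuous_sub {Φ Ψ : (H →L[ℂ] H) →L[ℂ] (H →L[ℂ] H)}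
    (hΦ : Continuous[weakStarTopology H, weakStarTopology H] Φ)
    (hΨ : Continuous[weakStarTopology H, weakStarTopology H] Ψ) :
    Continuous[weakStarTopology H, weakStarTopology H] ⇑(Φ - Ψ) := by
  rw [weakStar_continuous_iff] at *
  intro p
  let _ := weakStarTopology H
  simp only [sub_apply, map_sub]
  exact (hΦ p).sub (hΨ p)

theorem weakStar_continuous_mul {Φ Ψ : (H →L[ℂ] H) →L[ℂ] (H →L[ℂ] H)}
    (hΦ : Continuous[weakStarTopology H, weakStarTopology H] Φ)
    (hΨ : Continuous[weakStarTopology H, weakStarTopology H] Ψ) :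
    Continuous[weakStarTopology H, weakStarTopology H] ⇑(Φ * Ψ) := by
  exact @Continuous.comp _ _ _ (weakStarTopology H) (weakStarTopology H) (weakStarTopology H) Ψ Φ hΦ hΨ

/-- The functionals `T ↦ ∑ₙ ⟪yₙ, T xₙ⟫` form a subspace. -/
theorem exists_traceFunctional_of_mem_span {f : (H →L[ℂ] H) →ₗ[ℂ] ℂ}
    (hf : f ∈ Submodule.span ℂ (Set.range (traceFunctional (H := H)))) :
    ∃ p, f = traceFunctional p := by
  induction hf using Submodule.span_induction with
  | mem f h => obtain ⟨p, rfl⟩ := h; exact ⟨p, rfl⟩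
  | zero =>
    exact ⟨⟨(0, 0), by simp [summable_zero]⟩, by ext T; simp [traceFunctional]⟩
  | add f g _ _ hf hg =>
    obtain ⟨p, rfl⟩ := hf
    obtain ⟨q, rfl⟩ := hg
    -- A sum of two series becomes one series over `ℕ ⊕ ℕ`, reindexed by `ℕ`.
    let e : ℕ ⊕ ℕ ≃ ℕ := Equiv.natSumNatEquivNat
    have key : ∀ u v : ℕ → H, (Summable fun n => ‖u n‖ ^ 2) → (Summable fun n => ‖v n‖ ^ 2) →
        Summable fun n => ‖Sum.elim u v (e.symm n)‖ ^ 2 := fun u v hu hv => by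
      rw [← e.summable_iff]
      exact (HasSum.sum (by simpa [Function.comp_def] using hu.hasSum)
        (by simpa [Function.comp_def] using hv.hasSum)).summable
    refine ⟨⟨(fun n => Sum.elim p.1.1 q.1.1 (e.symm n), fun n => Sum.elim p.1.2 q.1.2 (e.symm n)),
      key _ _ p.2.1 q.2.1, key _ _ p.2.2 q.2.2⟩, ?_⟩
    ext T
    have := e.symm.tsum_eq
      (fun s => ⟪Sum.elim p.1.2 q.1.2 s, T (Sum.elim p.1.1 q.1.1 s)⟫_ℂ)
    simp only [traceFunctional, LinearMap.add_apply, LinearMap.coe_mk, AddHom.coe_mk]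
    rw [this, Summable.tsum_sum]
    · rfl
    · exact summable_inner_apply p.2.1 p.2.2 T
    · exact summable_inner_apply q.2.1 q.2.2 T
  | smul c f _ hf =>
    obtain ⟨p, rfl⟩ := hf
    refine ⟨⟨(fun n => c • p.1.1 n, p.1.2), ?_, p.2.2⟩, ?_⟩
    · simpa [norm_smul, mul_pow] using p.2.1.mul_left (‖c‖ ^ 2)
    · ext T
      simp [traceFunctional, tsum_mul_left]

/-- A weak* continuous functional is of the form `T ↦ ∑ₙ ⟪yₙ, T xₙ⟫`. -/
theorem exists_traceFunctional {f : (H →L[ℂ] H) →ₗ[ℂ] ℂ}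
    (hf : Continuous[weakStarTopology H, inferInstance] f) : ∃ p, f = traceFunctional p :=
  -- A functional continuous for the topology induced by a family of functionals lies in their
  -- linear span.
  exists_traceFunctional_of_mem_span ((LinearMap.mem_span_iff_continuous f).2 hf)

theorem continuous_weakStar_inner (u v : H) :
    Continuous[weakStarTopology H, inferInstance] fun T : H →L[ℂ] H => ⟪u, T v⟫_ℂ := by
  have hs : ∀ w : H, Summable fun n : ℕ => ‖(Pi.single 0 w : ℕ → H) n‖ ^ 2 := fun w =>
    summable_of_ne_finset_zero (s := {0}) fun n hn => by
      simp [Finset.notMem_singleton.1 hn]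
  convert continuous_traceFunctional (⟨(Pi.single 0 v, Pi.single 0 u), hs v, hs u⟩ : {p :
    (ℕ → H) × (ℕ → H) // (Summable fun n => ‖p.1 n‖ ^ 2) ∧ (Summable fun n => ‖p.2 n‖ ^ 2)})
    using 1
  ext T
  simp only [traceFunctional, LinearMap.coe_mk, AddHom.coe_mk]
  rw [tsum_eq_single 0 fun n hn => by simp [hn]]
  simp

/-- The matrix coefficients of a weak* continuous map are trace class functionals. -/
theorem exists_inner_map_eq_tsum {Φ : (H →L[ℂ] H) →L[ℂ] (H →L[ℂ] H)}
    (hΦ : Continuous[weakStarTopology H, weakStarTopology H] Φ) (u v : H) :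
    ∃ x y : ℕ → H, (Summable fun n => ‖x n‖ ^ 2) ∧ (Summable fun n => ‖y n‖ ^ 2) ∧
      ∀ T, ⟪u, Φ T v⟫_ℂ = ∑' n, ⟪y n, T (x n)⟫_ℂ := by
  have hc : Continuous[weakStarTopology H, inferInstance] fun T => ⟪u, Φ T v⟫_ℂ := by
    let _ := weakStarTopology H
    exact (continuous_weakStar_inner u v).comp hΦ
  let f : (H →L[ℂ] H) →ₗ[ℂ] ℂ :=
    { toFun := fun T => ⟪u, Φ T v⟫_ℂ
      map_add' := fun S T => by simp
      map_smul' := fun c T => by simp }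
  obtain ⟨p, hp⟩ := exists_traceFunctional (f := f) hc
  exact ⟨p.1.1, p.1.2, p.2.1, p.2.2, fun T => LinearMap.congr_fun hp T⟩

open InnerProductSpace in
/-- A weak* continuous map that vanishes on the operators of rank one is zero. -/
theorem eq_zero_of_rankOne [CompleteSpace H] {Φ : (H →L[ℂ] H) →L[ℂ] (H →L[ℂ] H)}
    (hΦ : Continuous[weakStarTopology H, weakStarTopology H] Φ)
    (h : ∀ p q : H, Φ (rankOne ℂ p q) = 0) : Φ = 0 := by
  ext T v
  refine ext_inner_left ℂ fun u => ?_
  obtain ⟨x, y, hx, hy, hxy⟩ := exists_inner_map_eq_tsum hΦ u v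
  obtain ⟨w, b, -⟩ := exists_hilbertBasis ℂ H
  -- The finite rank projections `F s` are contractions by Bessel's inequality and tend strongly to
  -- the identity. Hence `T * F s`, a finite sum of rank one operators, tends to `T` boundedly, and
  -- dominated convergence passes to the series.
  let F : Finset w → H →L[ℂ] H := fun s => ∑ i ∈ s, rankOne ℂ (b i) (b i)
  have hF : ∀ s z, F s z = ∑ i ∈ s, ⟪b i, z⟫_ℂ • b i := fun s z => by simp [F]
  have hFn : ∀ s z, ‖F s z‖ ≤ ‖z‖ := fun s z => by
    have h1 : ‖F s z‖ ^ 2 ≤ ‖z‖ ^ 2 := by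
      refine le_trans (le_of_eq ?_) (b.orthonormal.sum_inner_products_le (s := s) z)
      have h2 := b.orthonormal.inner_sum (fun i => ⟪b i, z⟫_ℂ) (fun i => ⟪b i, z⟫_ℂ) s
      rw [← hF, inner_self_eq_norm_sq_to_K] at h2
      have h3 : ∀ i, (starRingEnd ℂ) ⟪b i, z⟫_ℂ * ⟪b i, z⟫_ℂ = ((‖⟪b i, z⟫_ℂ‖ ^ 2 : ℝ) : ℂ) :=
        fun i => by rw [RCLike.conj_mul]; norm_cast
      simp only [h3] at h2
      exact Complex.ofReal_injective ((RCLike.ofReal_pow (K := ℂ) _ _).trans (h2.trans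
        (RCLike.ofReal_sum (K := ℂ) _ _).symm))
    exact le_of_sq_le_sq h1 (norm_nonneg z)
  have hFt : ∀ z, Filter.Tendsto (fun s => F s z) Filter.atTop (𝓝 z) := fun z => by
    have := b.hasSum_repr z
    simp only [HilbertBasis.repr_apply_apply] at this
    simpa only [hF, HasSum, SummationFilter.unconditional_filter] using this
  have hzero : ∀ s, Φ (T * F s) = 0 := fun s => by
    have : T * F s = ∑ i ∈ s, rankOne ℂ (T (b i)) (b i) := by
      ext z
      simp [F]
    simp [this, h]
  have hlim : Filter.Tendsto (fun s => ∑' n, ⟪y n, (T * F s) (x n)⟫_ℂ) Filter.atTop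
      (𝓝 (∑' n, ⟪y n, T (x n)⟫_ℂ)) := by
    refine tendsto_tsum_of_dominated_convergence
      (bound := fun n => ‖T‖ * (‖x n‖ ^ 2 + ‖y n‖ ^ 2)) ((hx.add hy).mul_left ‖T‖)
      (fun n => ?_) (Filter.Eventually.of_forall fun s n => ?_)
    · exact tendsto_const_nhds.inner ((T.continuous.tendsto _).comp (hFt (x n)))
    · refine (norm_inner_apply_le_sq T (F s (x n)) (y n)).trans ?_
      gcongr
      exact hFn s _
  simp only [← hxy, hzero] at hlim
  simpa using (tendsto_nhds_unique hlim tendsto_const_nhds)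

end SchurHyper

namespace SchurHyper

variable {H : Type*} [NormedAddCommGroup H] [InnerProductSpace ℂ H]

/-! ### Closed orbits of a vector under a space of operators -/

theorem inner_starProjection_of_mem {M : Submodule ℂ H} [M.HasOrthogonalProjection] {u : H}
    (hu : u ∈ M) (x : H) : ⟪u, M.starProjection x⟫_ℂ = ⟪u, x⟫_ℂ := by
  rw [← Submodule.inner_starProjection_left_eq_right, Submodule.starProjection_eq_self_iff.2 hu]

/-- The closed subspace `[X ξ]`. -/
noncomputable def closedOrbit (X : Submodule ℂ (H →L[ℂ] H)) (ξ : H) : Submodule ℂ H :=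
  (X.map (ContinuousLinearMap.apply ℂ H ξ : (H →L[ℂ] H) →ₗ[ℂ] H)).topologicalClosure

theorem apply_mem_closedOrbit {X : Submodule ℂ (H →L[ℂ] H)} {T : H →L[ℂ] H} (hT : T ∈ X) (ξ : H) :
    T ξ ∈ closedOrbit X ξ :=
  subset_closure ⟨T, hT, rfl⟩

theorem isClosed_closedOrbit (X : Submodule ℂ (H →L[ℂ] H)) (ξ : H) :
    IsClosed (closedOrbit X ξ : Set H) :=
  Submodule.isClosed_topologicalClosure _

theorem closedOrbit_induction {X : Submodule ℂ (H →L[ℂ] H)} {ξ : H} {p : H → Prop}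
    (hp : IsClosed {x | p x}) (h : ∀ T ∈ X, p (T ξ)) {x : H} (hx : x ∈ closedOrbit X ξ) : p x := by
  refine closure_minimal (t := {x | p x}) ?_ hp hx
  rintro _ ⟨T, hT, rfl⟩
  exact h T hT

theorem mapsTo_closedOrbit {X Y : Submodule ℂ (H →L[ℂ] H)} {ξ η : H} {a : H →L[ℂ] H}
    (h : ∀ T ∈ X, a (T ξ) ∈ closedOrbit Y η) {x : H} (hx : x ∈ closedOrbit X ξ) :
    a x ∈ closedOrbit Y η :=
  closedOrbit_induction (p := fun x => a x ∈ closedOrbit Y η)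
    ((isClosed_closedOrbit Y η).preimage a.continuous) h hx

variable [CompleteSpace H] {D : StarSubalgebra ℂ (H →L[ℂ] H)}

instance (X : Submodule ℂ (H →L[ℂ] H)) (ξ : H) : CompleteSpace (closedOrbit X ξ) :=
  (Submodule.isClosed_topologicalClosure _).completeSpace_coe

/-! ### Maximal abelian selfadjoint algebras and their invariant subspaces -/

theorem IsMasa.comm (hD : IsMasa D) {a b : H →L[ℂ] H} (ha : a ∈ D) (hb : b ∈ D) :
    a * b = b * a :=
  hD.prop a ha b hb

/-- The star algebra generated by `D` and `p` is commutative and contains `D`, so maximality makes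
it equal to `D`. -/
theorem IsMasa.mem_of_commute (hD : IsMasa D) {p : H →L[ℂ] H} (hp : IsSelfAdjoint p)
    (h : ∀ a ∈ D, a * p = p * a) : p ∈ D := by
  let s : Set (H →L[ℂ] H) := insert p D
  have hs : ∀ a ∈ s, ∀ b ∈ s, a * b = b * a := by
    rintro a (rfl | ha) b (rfl | hb)
    · rfl
    · exact (h b hb).symm
    · exact h a ha
    · exact hD.comm ha hb
  have hstar : ∀ b ∈ s, star b ∈ s := by
    rintro b (rfl | hb)
    · exact .inl hp
    · exact .inr (star_mem hb)
  have hc := StarAlgebra.isMulCommutative_adjoin ℂ hs fun a ha b hb => hs a ha _ (hstar b hb)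
  have hDs : D ≤ StarAlgebra.adjoin ℂ s := fun a ha =>
    StarAlgebra.subset_adjoin ℂ s (.inr ha)
  exact hD.le_of_ge (fun a ha b hb => setLike_mul_comm ha hb) hDs
    (StarAlgebra.subset_adjoin ℂ s (.inl rfl))

theorem inner_star_apply (a : H →L[ℂ] H) (x y : H) : ⟪star a x, y⟫_ℂ = ⟪x, a y⟫_ℂ := by
  rw [ContinuousLinearMap.star_eq_adjoint, ContinuousLinearMap.adjoint_inner_left]

theorem inner_apply_star (a : H →L[ℂ] H) (x y : H) : ⟪x, star a y⟫_ℂ = ⟪a x, y⟫_ℂ := by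
  rw [ContinuousLinearMap.star_eq_adjoint, ContinuousLinearMap.adjoint_inner_right]

/-- The projection onto an invariant subspace of a masa belongs to the masa. -/
theorem IsMasa.starProjection_mem (hD : IsMasa D) (M : Submodule ℂ H) [M.HasOrthogonalProjection]
    (hM : ∀ a ∈ D, ∀ x ∈ M, a x ∈ M) : M.starProjection ∈ D := by
  refine hD.mem_of_commute (isSelfAdjoint_starProjection M) fun a ha => ?_
  ext x
  refine (Submodule.eq_starProjection_of_mem_orthogonal
    (hM a ha _ (M.starProjection_apply_mem x)) ?_).symm
  -- The operator `a` preserves the orthogonal complement of `M` because `star a`, also in `D`,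
  -- preserves `M`.
  change a x - a (M.starProjection x) ∈ Mᗮ
  rw [← map_sub, Submodule.mem_orthogonal]
  intro u hu
  rw [← inner_star_apply]
  exact (Submodule.mem_orthogonal _ _).1 (M.sub_starProjection_mem_orthogonal x) _
    (hM _ (star_mem ha) u hu)

/-- The cyclic subspace `[D ξ]`. -/
noncomputable abbrev cyclicSubspace (D : StarSubalgebra ℂ (H →L[ℂ] H)) (ξ : H) : Submodule ℂ H :=
  closedOrbit (Subalgebra.toSubmodule D.toSubalgebra) ξ

theorem apply_mem_cyclicSubspace {a : H →L[ℂ] H} (ha : a ∈ D) (ξ : H) :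
    a ξ ∈ cyclicSubspace D ξ :=
  apply_mem_closedOrbit (X := Subalgebra.toSubmodule D.toSubalgebra) ha ξ

theorem self_mem_cyclicSubspace (ξ : H) : ξ ∈ cyclicSubspace D ξ :=
  apply_mem_cyclicSubspace (one_mem D) ξ

theorem cyclicSubspace_mono {ξ η : H} (h : ξ ∈ cyclicSubspace D η) :
    cyclicSubspace D ξ ≤ cyclicSubspace D η := fun _ hx =>
  mapsTo_closedOrbit (a := 1) (fun T hT => mapsTo_closedOrbit (a := T)
    (fun S hS => apply_mem_cyclicSubspace (a := T * S) (mul_mem hT hS) η) h) hx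

theorem cyclicSubspace_invariant {a : H →L[ℂ] H} (ha : a ∈ D) {ξ x : H}
    (hx : x ∈ cyclicSubspace D ξ) : a x ∈ cyclicSubspace D ξ :=
  mapsTo_closedOrbit (fun T hT => apply_mem_cyclicSubspace (a := a * T) (mul_mem ha hT) ξ) hx

theorem IsMasa.cyclicProjection_mem (hD : IsMasa D) (ξ : H) :
    (cyclicSubspace D ξ).starProjection ∈ D :=
  hD.starProjection_mem _ fun _ ha _ hx => cyclicSubspace_invariant ha hx

/-- Two vectors lie in a common cyclic subspace. -/
theorem IsMasa.exists_common_cyclic (hD : IsMasa D) (ξ v : H) :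
    ∃ η, ξ ∈ cyclicSubspace D η ∧ v ∈ cyclicSubspace D η := by
  set M := cyclicSubspace D ξ with hM
  have hP := hD.cyclicProjection_mem ξ
  have hξ : M.starProjection ξ = ξ :=
    Submodule.starProjection_eq_self_iff.2 (self_mem_cyclicSubspace ξ)
  have hPP : M.starProjection (M.starProjection v) = M.starProjection v :=
    Submodule.starProjection_eq_self_iff.2 (M.starProjection_apply_mem v)
  -- The two summands are orthogonal, and the projection onto `[D ξ]`, an element of `D`, recovers
  -- `ξ` from `η`. The rest of `v` lies in `[D ξ]`.
  set η := ξ + (v - M.starProjection v) with hη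
  have h1 : M.starProjection η = ξ := by rw [hη, map_add, map_sub, hPP, hξ]; simp
  have h2 : ξ ∈ cyclicSubspace D η := by
    have := apply_mem_cyclicSubspace hP η
    rwa [h1] at this
  have h3 : M.starProjection v ∈ cyclicSubspace D η :=
    cyclicSubspace_mono h2 (M.starProjection_apply_mem v)
  refine ⟨η, h2, ?_⟩
  have h4 : v = η - ξ + M.starProjection v := by rw [hη]; abel
  rw [h4]
  exact add_mem (sub_mem (self_mem_cyclicSubspace η) h2) h3

/-! ### The conjugation on a cyclic subspace -/

/-- Elements of `D` are normal. This makes `a ξ ↦ a* ξ` well defined and isometric. -/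
theorem IsMasa.norm_star_apply (hD : IsMasa D) {a : H →L[ℂ] H} (ha : a ∈ D) (x : H) :
    ‖star a x‖ = ‖a x‖ := by
  have h : ⟪star a x, star a x⟫_ℂ = ⟪a x, a x⟫_ℂ := by
    rw [inner_star_apply, ← inner_apply_star]
    exact congr(⟪x, $(hD.comm ha (star_mem ha)) x⟫_ℂ)
  rw [@norm_eq_sqrt_re_inner ℂ, h, ← @norm_eq_sqrt_re_inner ℂ]

/-- `y = J x` for the antilinear partial isometry `J` with `J (a ξ) = a* ξ` for `a ∈ D` and with
initial space `[D ξ]`. -/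
def IsConj (D : StarSubalgebra ℂ (H →L[ℂ] H)) (ξ x y : H) : Prop :=
  ∃ c : ℕ → H →L[ℂ] H, (∀ k, c k ∈ D) ∧
    Filter.Tendsto (fun k => c k ξ) Filter.atTop (𝓝 ((cyclicSubspace D ξ).starProjection x)) ∧
    Filter.Tendsto (fun k => star (c k) ξ) Filter.atTop (𝓝 y)

theorem IsMasa.exists_isConj (hD : IsMasa D) (ξ x : H) : ∃ y, IsConj D ξ x y := by
  have hx := (cyclicSubspace D ξ).starProjection_apply_mem x
  obtain ⟨u, hu, hlim⟩ := mem_closure_iff_seq_limit.1 hx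
  choose c hc hcu using hu
  replace hcu : ∀ k, c k ξ = u k := hcu
  have hcau : CauchySeq fun k => star (c k) ξ := by
    refine Metric.cauchySeq_iff.2 fun ε hε => ?_
    obtain ⟨N, hN⟩ := Metric.cauchySeq_iff.1 hlim.cauchySeq ε hε
    refine ⟨N, fun m hm n hn => ?_⟩
    have h1 : dist (star (c m) ξ) (star (c n) ξ) = ‖star (c m - c n) ξ‖ := by
      rw [dist_eq_norm, star_sub]; rfl
    rw [h1, hD.norm_star_apply (sub_mem (hc m) (hc n)), sub_apply, hcu, hcu, ← dist_eq_norm]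
    exact hN m hm n hn
  obtain ⟨y, hy⟩ := cauchySeq_tendsto_of_complete hcau
  exact ⟨y, c, hc, by simpa only [hcu] using hlim, hy⟩

theorem IsConj.mem {ξ x y : H} (h : IsConj D ξ x y) : y ∈ cyclicSubspace D ξ := by
  obtain ⟨c, hc, -, hy⟩ := h
  exact (isClosed_closedOrbit _ ξ).mem_of_tendsto hy
    (.of_forall fun k => apply_mem_cyclicSubspace (star_mem (hc k)) ξ)

theorem IsConj.norm_le (hD : IsMasa D) {ξ x y : H} (h : IsConj D ξ x y) : ‖y‖ ≤ ‖x‖ := by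
  obtain ⟨c, hc, hx, hy⟩ := h
  have hx' := hx.norm
  simp only [← hD.norm_star_apply (hc _)] at hx'
  rw [tendsto_nhds_unique hy.norm hx']
  exact Submodule.norm_starProjection_apply_le _ x

/-- For `x = c ξ`, `y = c* ξ` this is `b c = c b`. Limits give the general case, since only the
component of `x` in `[D ξ]` matters. -/
theorem IsConj.inner_apply (hD : IsMasa D) {ξ x y : H} (h : IsConj D ξ x y) {b : H →L[ℂ] H}
    (hb : b ∈ D) : ⟪ξ, b x⟫_ℂ = ⟪y, b ξ⟫_ℂ := by
  obtain ⟨c, hc, hx, hy⟩ := h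
  rw [← inner_star_apply,
    ← inner_starProjection_of_mem (apply_mem_cyclicSubspace (star_mem hb) ξ) x]
  have h1 := Filter.Tendsto.inner (𝕜 := ℂ) (tendsto_const_nhds (x := star b ξ)) hx
  refine tendsto_nhds_unique h1 ((hy.inner tendsto_const_nhds).congr fun k => ?_)
  rw [inner_star_apply, inner_star_apply]
  exact congr(⟪ξ, $(hD.comm (hc k) hb) ξ⟫_ℂ)

/-- The symmetry behind the commutation of Schur multipliers. Approximating `x` by `c ξ` reduces it
to the preceding identity for `b c`. -/
theorem IsConj.inner_apply_comm (hD : IsMasa D) {ξ x y x' y' : H} (h : IsConj D ξ x y)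
    (h' : IsConj D ξ x' y') {b : H →L[ℂ] H} (hb : b ∈ D) : ⟪y, b x'⟫_ℂ = ⟪y', b x⟫_ℂ := by
  obtain ⟨c, hc, hx, hy⟩ := h
  have hm := cyclicSubspace_invariant (star_mem hb) h'.mem
  rw [← inner_star_apply b y' x, ← inner_starProjection_of_mem hm x]
  have h1 := Filter.Tendsto.inner (𝕜 := ℂ) (tendsto_const_nhds (x := star b y')) hx
  refine tendsto_nhds_unique (hy.inner tendsto_const_nhds) (h1.congr fun k => ?_)
  rw [inner_star_apply, inner_star_apply]
  exact (h'.inner_apply hD (mul_mem hb (hc k))).symm.trans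
    congr(⟪ξ, $(hD.comm hb (hc k)) x'⟫_ℂ)

end SchurHyper

namespace SchurHyper

variable {H : Type*} [NormedAddCommGroup H] [InnerProductSpace ℂ H] [CompleteSpace H]
  {D : StarSubalgebra ℂ (H →L[ℂ] H)} {Φ Ψ : (H →L[ℂ] H) →L[ℂ] (H →L[ℂ] H)}

/-! ### Schur multipliers commute -/

open InnerProductSpace

theorem mul_rankOne_mul_star (a b : H →L[ℂ] H) (x y : H) :
    a * rankOne ℂ x y * star b = rankOne ℂ (a x) (b y) := by
  ext z
  simp [inner_apply_star]

theorem IsSchurMultiplier.inner_apply (hΦ : IsSchurMultiplier D Φ) {a b : H →L[ℂ] H}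
    (ha : a ∈ D) (hb : b ∈ D) (T : H →L[ℂ] H) (u v : H) :
    ⟪a u, Φ T (b v)⟫_ℂ = ⟪u, Φ (star a * T * b) v⟫_ℂ := by
  rw [hΦ.map_bimodule _ (star_mem ha) _ hb]
  exact (inner_apply_star a u _).symm

/-- The image of `ξ ⊗ ξ*` under a Schur multiplier, in terms of the functional
`T ↦ ⟪ξ, Φ(T) ξ⟫`. -/
theorem IsSchurMultiplier.exists_kernel (hD : IsMasa D) (hΦ : IsSchurMultiplier D Φ) (ξ : H) :
    ∃ x y x' y' : ℕ → H, (Summable fun n => ‖x n‖ ^ 2) ∧ (Summable fun n => ‖y n‖ ^ 2) ∧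
      (∀ n, IsConj D ξ (x n) (x' n)) ∧ (∀ n, IsConj D ξ (y n) (y' n)) ∧
      (∀ a ∈ D, ∀ b ∈ D, ∀ T : H →L[ℂ] H,
        ⟪a ξ, Φ T (b ξ)⟫_ℂ = ∑' n, ⟪a (y n), T (b (x n))⟫_ℂ) ∧
      ∀ u v, ⟪u, Φ (rankOne ℂ ξ ξ) v⟫_ℂ = ∑' n, ⟪u, y' n⟫_ℂ * ⟪x' n, v⟫_ℂ := by
  obtain ⟨x, y, hx, hy, hxy⟩ := exists_inner_map_eq_tsum hΦ.weakStar_continuous ξ ξ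
  choose x' hx' using fun n => hD.exists_isConj ξ (x n)
  choose y' hy' using fun n => hD.exists_isConj ξ (y n)
  have hab : ∀ a ∈ D, ∀ b ∈ D, ∀ T : H →L[ℂ] H,
      ⟪a ξ, Φ T (b ξ)⟫_ℂ = ∑' n, ⟪a (y n), T (b (x n))⟫_ℂ := fun a ha b hb T => by
    rw [hΦ.inner_apply ha hb, hxy]
    exact tsum_congr fun n => inner_apply_star a (y n) _
  refine ⟨x, y, x', y', hx, hy, hx', hy', hab, ?_⟩
  have hsum : Summable fun n => rankOne ℂ (y' n) (x' n) := by
    refine .of_norm_bounded (summable_norm_mul_norm hx hy) fun n => ?_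
    rw [norm_rankOne]
    gcongr
    · exact (hy' n).norm_le hD
    · exact (hx' n).norm_le hD
  set K := Φ (rankOne ℂ ξ ξ) with hK
  set K' := ∑' n, rankOne ℂ (y' n) (x' n) with hK'
  have hK'uv : ∀ u v, ⟪u, K' v⟫_ℂ = ∑' n, ⟪u, y' n⟫_ℂ * ⟪x' n, v⟫_ℂ := fun u v => by
    have := hsum.hasSum.mapL ((innerSL ℂ u) ∘L (ContinuousLinearMap.apply ℂ H v))
    rw [← hK'] at this
    have h2 := this.tsum_eq
    simp only [ContinuousLinearMap.comp_apply, ContinuousLinearMap.apply_apply, innerSL_apply_apply,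
      rankOne_apply, inner_smul_right] at h2
    rw [← h2]
    exact tsum_congr fun n => mul_comm _ _
  -- Each term is `⟪a y, ξ⟫ ⟪ξ, b x⟫`, and `J` moves `x` and `y` past `ξ`.
  have horbit : ∀ a ∈ D, ∀ b ∈ D, ⟪a ξ, K (b ξ)⟫_ℂ = ⟪a ξ, K' (b ξ)⟫_ℂ := fun a ha b hb => by
    rw [hab a ha b hb, hK'uv]
    refine tsum_congr fun n => ?_
    rw [rankOne_apply, inner_smul_right, (hx' n).inner_apply hD hb, mul_comm,
      ← inner_conj_symm (a (y n)) ξ, (hy' n).inner_apply hD ha, inner_conj_symm]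
  set M := cyclicSubspace D ξ with hM
  have hcyc : ∀ u ∈ M, ∀ v ∈ M, ⟪u, K v⟫_ℂ = ⟪u, K' v⟫_ℂ := fun u hu v hv => by
    refine closedOrbit_induction (p := fun u => ⟪u, K v⟫_ℂ = ⟪u, K' v⟫_ℂ)
      (isClosed_eq (by fun_prop) (by fun_prop)) (fun a ha => ?_) hu
    exact closedOrbit_induction (p := fun v => ⟪a ξ, K v⟫_ℂ = ⟪a ξ, K' v⟫_ℂ)
      (isClosed_eq (by fun_prop) (by fun_prop)) (fun b hb => horbit a ha b hb) hv
  intro u v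
  have hP := hD.cyclicProjection_mem ξ
  have hPξ : M.starProjection ξ = ξ :=
    Submodule.starProjection_eq_self_iff.2 (self_mem_cyclicSubspace ξ)
  -- The projection onto `[D ξ]` lies in `D` and fixes `ξ`, so `K` lives on `[D ξ]` and testing
  -- there suffices.
  have h1 : ⟪u, K v⟫_ℂ = ⟪M.starProjection u, K (M.starProjection v)⟫_ℂ := by
    have hPP : M.starProjection * rankOne ℂ ξ ξ * star M.starProjection = rankOne ℂ ξ ξ := by
      rw [mul_rankOne_mul_star, hPξ]
    rw [(isSelfAdjoint_starProjection M).star_eq] at hPP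
    rw [hΦ.inner_apply hP hP, (isSelfAdjoint_starProjection _).star_eq, hPP]
  rw [h1, hcyc _ (M.starProjection_apply_mem u) _ (M.starProjection_apply_mem v), hK'uv]
  refine tsum_congr fun n => ?_
  rw [inner_starProjection_of_mem (hx' n).mem, ← inner_conj_symm,
    inner_starProjection_of_mem (hy' n).mem, inner_conj_symm]

/-- Both sides expand into the same double series, summed in opposite orders. The symmetry of `J`
matches the terms. -/
theorem IsSchurMultiplier.inner_mul_apply_rankOne_comm (hD : IsMasa D)
    (hΦ : IsSchurMultiplier D Φ) (hΨ : IsSchurMultiplier D Ψ) (ξ : H) {a b : H →L[ℂ] H}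
    (ha : a ∈ D) (hb : b ∈ D) :
    ⟪a ξ, Φ (Ψ (rankOne ℂ ξ ξ)) (b ξ)⟫_ℂ = ⟪a ξ, Ψ (Φ (rankOne ℂ ξ ξ)) (b ξ)⟫_ℂ := by
  obtain ⟨x, y, x', y', hx, hy, hx', hy', h1, h2⟩ := hΦ.exists_kernel hD ξ
  obtain ⟨z, w, z', w', hz, hw, hz', hw', h3, h4⟩ := hΨ.exists_kernel hD ξ
  rw [h1 a ha b hb, h3 a ha b hb]
  simp only [h2, h4]
  rw [Summable.tsum_comm]
  · refine tsum_congr fun m => tsum_congr fun n => ?_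
    rw [(hz' m).inner_apply_comm hD (hx' n) hb, ← inner_conj_symm,
      (hw' m).inner_apply_comm hD (hy' n) ha, inner_conj_symm]
  -- Absolute convergence of the double series, which justifies the interchange.
  · have hs := (summable_norm_mul_norm hz hw).mul_of_nonneg (summable_norm_mul_norm hx hy)
      (fun _ => by positivity) (fun _ => by positivity)
    refine .of_norm_bounded (hs.mul_left (‖a‖ * ‖b‖)) fun p => ?_
    rw [Function.uncurry_def, norm_mul]
    calc ‖⟪a (y p.2), w' p.1⟫_ℂ‖ * ‖⟪z' p.1, b (x p.2)⟫_ℂ‖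
        ≤ (‖a‖ * ‖y p.2‖ * ‖w p.1‖) * (‖z p.1‖ * (‖b‖ * ‖x p.2‖)) := by
          gcongr
          · exact (norm_inner_le_norm _ _).trans
              (mul_le_mul (a.le_opNorm _) ((hw' _).norm_le hD) (by positivity) (by positivity))
          · exact (norm_inner_le_norm _ _).trans
              (mul_le_mul ((hz' _).norm_le hD) (b.le_opNorm _) (by positivity) (by positivity))
      _ = _ := by ring

/-- All four vectors `p`, `q`, `u`, `v` lie in one `[D ξ]`. By density they may be taken in `D ξ`,
and the bimodule property moves the coefficients outside. -/
theorem IsSchurMultiplier.apply_rankOne_comm (hD : IsMasa D) (hΦ : IsSchurMultiplier D Φ)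
    (hΨ : IsSchurMultiplier D Ψ) (p q : H) :
    Φ (Ψ (rankOne ℂ p q)) = Ψ (Φ (rankOne ℂ p q)) := by
  ext v
  refine ext_inner_left ℂ fun u => ?_
  obtain ⟨ξ₁, hp, hq⟩ := hD.exists_common_cyclic p q
  obtain ⟨ξ₂, h₁, hu⟩ := hD.exists_common_cyclic ξ₁ u
  obtain ⟨ξ, h₂, hv⟩ := hD.exists_common_cyclic ξ₂ v
  replace hu := cyclicSubspace_mono h₂ hu
  replace h₁ := cyclicSubspace_mono h₂ h₁
  replace hp := cyclicSubspace_mono h₁ hp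
  replace hq := cyclicSubspace_mono h₁ hq
  refine closedOrbit_induction
    (p := fun u => ⟪u, Φ (Ψ (rankOne ℂ p q)) v⟫_ℂ = ⟪u, Ψ (Φ (rankOne ℂ p q)) v⟫_ℂ)
    (isClosed_eq (by fun_prop) (by fun_prop)) (fun a ha => ?_) hu
  refine closedOrbit_induction
    (p := fun v => ⟪a ξ, Φ (Ψ (rankOne ℂ p q)) v⟫_ℂ = ⟪a ξ, Ψ (Φ (rankOne ℂ p q)) v⟫_ℂ)
    (isClosed_eq (by fun_prop) (by fun_prop)) (fun b hb => ?_) hv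
  refine closedOrbit_induction (p := fun p =>
    ⟪a ξ, Φ (Ψ (rankOne ℂ p q)) (b ξ)⟫_ℂ = ⟪a ξ, Ψ (Φ (rankOne ℂ p q)) (b ξ)⟫_ℂ)
    (isClosed_eq (by fun_prop) (by fun_prop)) (fun c hc => ?_) hp
  refine closedOrbit_induction (p := fun q =>
    ⟪a ξ, Φ (Ψ (rankOne ℂ (c ξ) q)) (b ξ)⟫_ℂ = ⟪a ξ, Ψ (Φ (rankOne ℂ (c ξ) q)) (b ξ)⟫_ℂ)
    (isClosed_eq (by fun_prop) (by fun_prop)) (fun d hd => ?_) hq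
  replace ha : a ∈ D := ha
  replace hb : b ∈ D := hb
  replace hc : c ∈ D := hc
  replace hd : star d ∈ D := star_mem hd
  have key := inner_mul_apply_rankOne_comm hD hΦ hΨ ξ (mul_mem (star_mem hc) ha) (mul_mem hd hb)
  rw [← mul_rankOne_mul_star, hΦ.map_bimodule c hc _ hd, hΨ.map_bimodule c hc _ hd,
    hΦ.map_bimodule c hc _ hd, hΨ.map_bimodule c hc _ hd]
  simp only [mul_apply_eq_comp, inner_star_apply] at key ⊢
  exact key

theorem IsSchurMultiplier.mul (hΦ : IsSchurMultiplier D Φ) (hΨ : IsSchurMultiplier D Ψ) :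
    IsSchurMultiplier D (Φ * Ψ) where
  weakStar_continuous := weakStar_continuous_mul hΦ.1 hΨ.1
  map_bimodule a ha b hb T := by
    simp only [mul_apply_eq_comp, hΨ.map_bimodule a ha b hb,
      hΦ.map_bimodule a ha b hb]

theorem IsSchurMultiplier.add (hΦ : IsSchurMultiplier D Φ) (hΨ : IsSchurMultiplier D Ψ) :
    IsSchurMultiplier D (Φ + Ψ) where
  weakStar_continuous := weakStar_continuous_add hΦ.1 hΨ.1
  map_bimodule a ha b hb T := by
    simp only [add_apply, hΨ.map_bimodule a ha b hb, hΦ.map_bimodule a ha b hb, mul_add, add_mul]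

theorem IsSchurMultiplier.sub (hΦ : IsSchurMultiplier D Φ) (hΨ : IsSchurMultiplier D Ψ) :
    IsSchurMultiplier D (Φ - Ψ) where
  weakStar_continuous := weakStar_continuous_sub hΦ.1 hΨ.1
  map_bimodule a ha b hb T := by
    simp only [sub_apply, hΨ.map_bimodule a ha b hb, hΦ.map_bimodule a ha b hb, mul_sub, sub_mul]

theorem IsSchurMultiplier.one (D : StarSubalgebra ℂ (H →L[ℂ] H)) :
    IsSchurMultiplier D 1 where
  weakStar_continuous := @continuous_id _ (weakStarTopology H)
  map_bimodule _ _ _ _ _ := rfl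

theorem IsSchurMultiplier.zero (D : StarSubalgebra ℂ (H →L[ℂ] H)) :
    IsSchurMultiplier D 0 where
  weakStar_continuous := @continuous_const _ _ (weakStarTopology H) (weakStarTopology H) 0
  map_bimodule _ _ _ _ _ := by simp

/-- Schur multipliers commute. -/
theorem IsSchurMultiplier.comm (hD : IsMasa D) (hΦ : IsSchurMultiplier D Φ)
    (hΨ : IsSchurMultiplier D Ψ) : Φ * Ψ = Ψ * Φ :=
  sub_eq_zero.1 <| eq_zero_of_rankOne ((hΦ.mul hΨ).sub (hΨ.mul hΦ)).weakStar_continuous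
    fun p q => sub_eq_zero.2 (apply_rankOne_comm hD hΦ hΨ p q)

end SchurHyper

namespace SchurHyper

variable {H : Type*} [NormedAddCommGroup H] [InnerProductSpace ℂ H]

/-! ### The Arveson distance -/

theorem bddBelow_range_norm {ι E : Type*} [SeminormedAddCommGroup E] (f : ι → E) :
    BddBelow (Set.range fun i => ‖f i‖) :=
  ⟨0, by rintro _ ⟨i, rfl⟩; exact norm_nonneg _⟩

theorem arvesonDist_nonneg (T : H →L[ℂ] H) (X : Submodule ℂ (H →L[ℂ] H)) :
    0 ≤ arvesonDist T X :=
  Real.iSup_nonneg fun _ => Real.iInf_nonneg fun _ => norm_nonneg _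

theorem bddAbove_arvesonDist (T : H →L[ℂ] H) (X : Submodule ℂ (H →L[ℂ] H)) :
    BddAbove (Set.range fun ξ : {ξ : H // ‖ξ‖ = 1} =>
      ⨅ S : X, ‖T (ξ : H) - (S : H →L[ℂ] H) (ξ : H)‖) := by
  refine ⟨‖T‖, ?_⟩
  rintro _ ⟨ξ, rfl⟩
  refine (ciInf_le (bddBelow_range_norm _) (0 : X)).trans ?_
  simpa [ξ.2] using T.le_opNorm ξ

/-- Homogeneity in `ξ`; needed because a compression sends unit vectors to shorter ones. -/
theorem iInf_le_arvesonDist_mul (T : H →L[ℂ] H) (X : Submodule ℂ (H →L[ℂ] H)) (ξ : H) :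
    ⨅ S : X, ‖T ξ - (S : H →L[ℂ] H) ξ‖ ≤ arvesonDist T X * ‖ξ‖ := by
  rcases eq_or_ne ξ 0 with rfl | hξ
  · simp
  have hξ' : ‖ξ‖ ≠ 0 := norm_ne_zero_iff.2 hξ
  set c : ℂ := ((‖ξ‖⁻¹ : ℝ) : ℂ) with hc
  have hcn : ‖c‖ = ‖ξ‖⁻¹ := by simp [hc]
  have h1 : ‖c • ξ‖ = 1 := by rw [norm_smul, hcn, inv_mul_cancel₀ hξ']
  have h2 := le_ciSup (bddAbove_arvesonDist T X) ⟨c • ξ, h1⟩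
  have h3 : ∀ S : X, ‖T (c • ξ) - (S : H →L[ℂ] H) (c • ξ)‖ =
      ‖ξ‖⁻¹ * ‖T ξ - (S : H →L[ℂ] H) ξ‖ := fun S => by
    rw [map_smul, map_smul, ← smul_sub, norm_smul, hcn]
  simp only [h3] at h2
  rw [← Real.mul_iInf_of_nonneg (by positivity)] at h2
  calc _ = (‖ξ‖⁻¹ * ⨅ S : X, ‖T ξ - (S : H →L[ℂ] H) ξ‖) * ‖ξ‖ := by field_simp
    _ ≤ _ := by gcongr; exact h2

theorem arvesonDist_le {T : H →L[ℂ] H} {X : Submodule ℂ (H →L[ℂ] H)} {c : ℝ} (hc : 0 ≤ c)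
    (h : ∀ ξ : H, ‖ξ‖ = 1 → ⨅ S : X, ‖T ξ - (S : H →L[ℂ] H) ξ‖ ≤ c) : arvesonDist T X ≤ c :=
  Real.iSup_le (fun ξ => h ξ ξ.2) hc

theorem arvesonDist_anti {T : H →L[ℂ] H} {X Y : Submodule ℂ (H →L[ℂ] H)} (h : X ≤ Y) :
    arvesonDist T Y ≤ arvesonDist T X := by
  refine arvesonDist_le (arvesonDist_nonneg T X) fun ξ hξ => ?_
  have h1 := iInf_le_arvesonDist_mul T X ξ
  rw [hξ, mul_one] at h1
  exact le_trans (le_ciInf fun S : X => ciInf_le (bddBelow_range_norm _) (⟨S.1, h S.2⟩ : Y)) h1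

/-- Compressing to contractions `R` and `P` with `R Y P ⊆ X` does not increase the
Arveson distance. -/
theorem arvesonDist_mul_mul_le {T R P : H →L[ℂ] H} {X Y : Submodule ℂ (H →L[ℂ] H)}
    (hR : ‖R‖ ≤ 1) (hP : ‖P‖ ≤ 1) (h : ∀ S ∈ Y, R * S * P ∈ X) :
    arvesonDist (R * T * P) X ≤ arvesonDist T Y := by
  refine arvesonDist_le (arvesonDist_nonneg T Y) fun ξ hξ => ?_
  have h1 := iInf_le_arvesonDist_mul T Y (P ξ)
  have h2 : ‖P ξ‖ ≤ 1 := by simpa [hξ] using P.le_of_opNorm_le hP ξ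
  refine le_trans (le_ciInf fun S => ?_)
    (h1.trans (mul_le_of_le_one_right (arvesonDist_nonneg T Y) h2))
  refine (ciInf_le (bddBelow_range_norm _) (⟨_, h S S.2⟩ : X)).trans ?_
  calc ‖(R * T * P) ξ - (R * (S : H →L[ℂ] H) * P) ξ‖
      = ‖R (T (P ξ) - (S : H →L[ℂ] H) (P ξ))‖ := by rw [map_sub]; rfl
    _ ≤ _ := by simpa using R.le_of_opNorm_le hR (T (P ξ) - (S : H →L[ℂ] H) (P ξ))

/-- The distance of `v` to `X ξ` is at most the norm of the component of `v` orthogonal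
to `[X ξ]`. -/
theorem iInf_norm_sub_le_of_mem_closedOrbit {X : Submodule ℂ (H →L[ℂ] H)} {ξ v w : H}
    (hw : w ∈ closedOrbit X ξ) : ⨅ S : X, ‖v - (S : H →L[ℂ] H) ξ‖ ≤ ‖v - w‖ := by
  refine closedOrbit_induction (p := fun w => ⨅ S : X, ‖v - (S : H →L[ℂ] H) ξ‖ ≤ ‖v - w‖)
    (isClosed_le (by fun_prop) (by fun_prop)) (fun T hT => ?_) hw
  exact ciInf_le (bddBelow_range_norm fun S : X => v - (S : H →L[ℂ] H) ξ) ⟨T, hT⟩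

variable [CompleteSpace H]

namespace SchurIdempotent

variable {D : StarSubalgebra ℂ (H →L[ℂ] H)}

/-! ### The lattice of Schur idempotents -/

theorem ext {Φ Ψ : SchurIdempotent D} (h : Φ.map = Ψ.map) : Φ = Ψ := Subtype.ext h

theorem isSchurMultiplier (Φ : SchurIdempotent D) : IsSchurMultiplier D Φ.map := Φ.2.1

theorem map_mul_map (Φ : SchurIdempotent D) : Φ.map * Φ.map = Φ.map := Φ.2.2

theorem map_mul_comm (hD : IsMasa D) (Φ Ψ : SchurIdempotent D) : Φ.map * Ψ.map = Ψ.map * Φ.map :=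
  Φ.isSchurMultiplier.comm hD Ψ.isSchurMultiplier

/-- Distributivity of join over meet, written in the ring. -/
theorem add_sub_mul_mul_add_sub_mul {R : Type*} [Ring R] {e f g : R} (hef : e * f = f * e)
    (he : e * e = e) :
    (e + f - e * f) * (e + g - e * g) = e + f * g - e * (f * g) := by
  have h : e * f * e = e * f := by rw [hef, mul_assoc, he]
  simp only [mul_add, add_mul, sub_mul, mul_sub, ← mul_assoc, he, h, ← hef]
  abel

/-- The Boolean algebra of the Schur idempotents of a masa. -/
@[reducible] noncomputable def booleanAlgebra (hD : IsMasa D) :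
    BooleanAlgebra (SchurIdempotent D) where
  le Φ Ψ := Φ.map * Ψ.map = Φ.map
  le_refl Φ := Φ.map_mul_map
  le_trans Φ Ψ Θ h₁ h₂ := by rw [← h₁, mul_assoc, h₂]
  le_antisymm Φ Ψ h₁ h₂ := ext (by rw [← h₁, map_mul_comm hD, h₂])
  inf Φ Ψ := ⟨Φ.map * Ψ.map, Φ.isSchurMultiplier.mul Ψ.isSchurMultiplier,
    IsIdempotentElem.mul_of_commute (map_mul_comm hD Φ Ψ) Φ.map_mul_map Ψ.map_mul_map⟩
  sup Φ Ψ := ⟨Φ.map + Ψ.map - Φ.map * Ψ.map,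
    (Φ.isSchurMultiplier.add Ψ.isSchurMultiplier).sub
      (Φ.isSchurMultiplier.mul Ψ.isSchurMultiplier),
    IsIdempotentElem.add_sub_mul_of_commute (map_mul_comm hD Φ Ψ) Φ.map_mul_map Ψ.map_mul_map⟩
  compl Φ := ⟨1 - Φ.map, (IsSchurMultiplier.one D).sub Φ.isSchurMultiplier,
    IsIdempotentElem.one_sub Φ.map_mul_map⟩
  top := ⟨1, IsSchurMultiplier.one D, one_mul 1⟩
  bot := ⟨0, IsSchurMultiplier.zero D, zero_mul 0⟩
  le_top Φ := mul_one Φ.map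
  bot_le Φ := zero_mul Φ.map
  inf_le_left Φ Ψ := by
    change Φ.map * Ψ.map * Φ.map = Φ.map * Ψ.map
    rw [map_mul_comm hD Φ Ψ, mul_assoc, Φ.map_mul_map]
  inf_le_right Φ Ψ := by
    change Φ.map * Ψ.map * Ψ.map = Φ.map * Ψ.map
    rw [mul_assoc, Ψ.map_mul_map]
  le_inf Φ Ψ Θ h₁ h₂ := by
    change Φ.map * (Ψ.map * Θ.map) = Φ.map
    rw [← mul_assoc, h₁, h₂]
  le_sup_left Φ Ψ := by
    change Φ.map * (Φ.map + Ψ.map - Φ.map * Ψ.map) = Φ.map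
    rw [mul_sub, mul_add, ← mul_assoc, Φ.map_mul_map, add_sub_cancel_right]
  le_sup_right Φ Ψ := by
    change Ψ.map * (Φ.map + Ψ.map - Φ.map * Ψ.map) = Ψ.map
    rw [map_mul_comm hD Φ Ψ, mul_sub, mul_add, ← mul_assoc, Ψ.map_mul_map, add_sub_cancel_left]
  sup_le Φ Ψ Θ h₁ h₂ := by
    change (Φ.map + Ψ.map - Φ.map * Ψ.map) * Θ.map = Φ.map + Ψ.map - Φ.map * Ψ.map
    rw [sub_mul, add_mul, mul_assoc, h₁, h₂]
  le_sup_inf Φ Ψ Θ := by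
    change (Φ.map + Ψ.map - Φ.map * Ψ.map) * (Φ.map + Θ.map - Φ.map * Θ.map) *
      (Φ.map + Ψ.map * Θ.map - Φ.map * (Ψ.map * Θ.map)) =
      (Φ.map + Ψ.map - Φ.map * Ψ.map) * (Φ.map + Θ.map - Φ.map * Θ.map)
    rw [add_sub_mul_mul_add_sub_mul (map_mul_comm hD Φ Ψ) Φ.map_mul_map]
    exact IsIdempotentElem.add_sub_mul_of_commute
      (Commute.mul_right (map_mul_comm hD Φ Ψ) (map_mul_comm hD Φ Θ)) Φ.map_mul_map
      (IsIdempotentElem.mul_of_commute (map_mul_comm hD Ψ Θ) Ψ.map_mul_map Θ.map_mul_map)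
  inf_compl_le_bot Φ := by
    change Φ.map * (1 - Φ.map) * 0 = Φ.map * (1 - Φ.map)
    rw [mul_zero, IsIdempotentElem.mul_one_sub_self Φ.map_mul_map]
  top_le_sup_compl Φ := by
    change 1 * (Φ.map + (1 - Φ.map) - Φ.map * (1 - Φ.map)) = 1
    rw [IsIdempotentElem.mul_one_sub_self Φ.map_mul_map, one_mul, add_sub_cancel, sub_zero]

/-! ### Hyperreflexive ranges -/

theorem mem_ran {Φ : SchurIdempotent D} {T : H →L[ℂ] H} : T ∈ Φ.ran ↔ Φ.map T = T := by
  refine ⟨?_, fun h => ⟨T, h⟩⟩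
  rintro ⟨S, rfl⟩
  exact congr($(Φ.map_mul_map) S)

theorem map_mem_ran (Φ : SchurIdempotent D) (T : H →L[ℂ] H) : Φ.map T ∈ Φ.ran := ⟨T, rfl⟩

theorem mul_mul_mem_ran {Φ : SchurIdempotent D} {a b T : H →L[ℂ] H} (ha : a ∈ D) (hb : b ∈ D)
    (hT : T ∈ Φ.ran) : a * T * b ∈ Φ.ran := by
  rw [mem_ran] at *
  rw [Φ.isSchurMultiplier.map_bimodule a ha b hb, hT]

theorem mem_estimateSet_of_nonneg {Φ : SchurIdempotent D} {c : ℝ} (hc : 0 ≤ c)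
    (h : Φ.Estimate c) : Φ ∈ estimateSet D :=
  -- The definition of `estimateSet` asks for a strictly positive constant, while `c` may be `0`.
  ⟨c + 1, by positivity, fun T => (h T).trans
    (mul_le_mul_of_nonneg_right (by linarith) (arvesonDist_nonneg _ _))⟩

theorem estimateConst_le {Φ : SchurIdempotent D} {c : ℝ} (hc : 0 ≤ c) (h : Φ.Estimate c) :
    Φ.estimateConst ≤ c :=
  csInf_le ⟨0, fun _ hc => hc.1⟩ ⟨hc, h⟩

/-- `Φ(T)` competes in the distance to the range. Conversely `id - Φ` kills the range, so `‖T -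
Φ(T)‖` is at most `‖id - Φ‖` times the distance. -/
theorem mem_estimateSet_iff (Φ : SchurIdempotent D) :
    Φ ∈ estimateSet D ↔ IsHyperreflexive Φ.ran := by
  constructor
  · rintro ⟨c, hc, h⟩
    exact ⟨c, hc, fun T => (ciInf_le (bddBelow_range_norm _)
      (⟨_, Φ.map_mem_ran T⟩ : Φ.ran)).trans (h T)⟩
  · rintro ⟨k, hk, h⟩
    have hdist : ∀ T, ‖T - Φ.map T‖ ≤ ‖1 - Φ.map‖ * opDist T Φ.ran := fun T => by
      rw [opDist, Real.mul_iInf_of_nonneg (norm_nonneg _)]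
      refine le_ciInf fun S => ?_
      have h1 : T - Φ.map T = (1 - Φ.map) (T - S) := by
        have := mem_ran.1 S.2
        simp [this]
      rw [h1]
      exact (1 - Φ.map).le_opNorm _
    refine mem_estimateSet_of_nonneg (c := ‖1 - Φ.map‖ * k) (by positivity) fun T => ?_
    rw [mul_assoc]
    exact (hdist T).trans (by gcongr; exact h T)

/-- The estimate for the composition of two Schur idempotents. -/
theorem Estimate.mul {Φ₁ Φ₂ Ψ : SchurIdempotent D} (hΨ : Ψ.map = Φ₁.map * Φ₂.map)
    (hcomm : Φ₁.map * Φ₂.map = Φ₂.map * Φ₁.map) {c₁ c₂ : ℝ} (hc₁ : 0 ≤ c₁) (hc₂ : 0 ≤ c₂)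
    (h₁ : Φ₁.Estimate c₁) (h₂ : Φ₂.Estimate c₂) : Ψ.Estimate (c₁ + c₂ * ‖Φ₁.map‖) := fun T => by
  have hr₁ : Ψ.ran ≤ Φ₁.ran := by
    rintro _ ⟨S, rfl⟩
    exact ⟨Φ₂.map S, congr($hΨ S).symm⟩
  have hr₂ : Ψ.ran ≤ Φ₂.ran := by
    rintro _ ⟨S, rfl⟩
    exact ⟨Φ₁.map S, congr($(hΨ.trans hcomm) S).symm⟩
  calc ‖T - Ψ.map T‖ = ‖(T - Φ₁.map T) + Φ₁.map (T - Φ₂.map T)‖ := by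
        rw [hΨ, map_sub]; simp
    _ ≤ ‖T - Φ₁.map T‖ + ‖Φ₁.map‖ * ‖T - Φ₂.map T‖ :=
        (norm_add_le _ _).trans (by gcongr; exact Φ₁.map.le_opNorm _)
    _ ≤ c₁ * arvesonDist T Ψ.ran + ‖Φ₁.map‖ * (c₂ * arvesonDist T Ψ.ran) := by
        gcongr
        · exact (h₁ T).trans (by gcongr; exact arvesonDist_anti hr₁)
        · exact (h₂ T).trans (by gcongr; exact arvesonDist_anti hr₂)
    _ = _ := by ring

/-- The estimate for the join of two Schur idempotents. -/
theorem Estimate.sup (hD : IsMasa D) {Φ₁ Φ₂ Ψ : SchurIdempotent D}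
    (hΨ : Ψ.map = Φ₁.map + Φ₂.map - Φ₁.map * Φ₂.map) {c₁ c₂ : ℝ} (hc₁ : 0 ≤ c₁) (hc₂ : 0 ≤ c₂)
    (h₁ : Φ₁.Estimate c₁) (h₂ : Φ₂.Estimate c₂) : Ψ.Estimate (c₁ * c₂) := fun T => by
  set S := T - Φ₂.map T with hS
  have h0 : T - Ψ.map T = S - Φ₁.map S := by
    rw [hΨ, hS, map_sub]
    simp only [sub_apply, add_apply, mul_apply_eq_comp]
    abel
  rw [h0, mul_assoc]
  refine (h₁ S).trans (mul_le_mul_of_nonneg_left ?_ hc₁)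
  refine arvesonDist_le (mul_nonneg hc₂ (arvesonDist_nonneg _ _)) fun ξ hξ => ?_
  set Q := (closedOrbit Φ₁.ran ξ).starProjection with hQ
  set P := (cyclicSubspace D ξ).starProjection with hP
  have hPD : P ∈ D := hD.cyclicProjection_mem ξ
  have hQD : 1 - Q ∈ D := sub_mem (one_mem D) <| hD.starProjection_mem _ fun a ha x hx =>
    mapsTo_closedOrbit (fun V hV => by
      have := mul_mul_mem_ran ha (one_mem D) hV
      rw [mul_one] at this
      exact apply_mem_closedOrbit this ξ) hx
  have hPn : ‖P‖ ≤ 1 := Submodule.starProjection_norm_le _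
  have hQn : ‖1 - Q‖ ≤ 1 := by
    have : 1 - Q = (closedOrbit Φ₁.ran ξ)ᗮ.starProjection := by
      rw [Submodule.starProjection_orthogonal]; rfl
    rw [this]
    exact Submodule.starProjection_norm_le _
  have hPξ : P ξ = ξ := Submodule.starProjection_eq_self_iff.2 (self_mem_cyclicSubspace ξ)
  -- Since `V` commutes past `D` within `ran Φ₁`, it maps `[D ξ]` into `[ran Φ₁ ξ]`, which `1 - Q`
  -- annihilates.
  have hzero : ∀ V ∈ Φ₁.ran, (1 - Q) * V * P = 0 := fun V hV => by
    ext η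
    have hm : V (P η) ∈ closedOrbit Φ₁.ran ξ := by
      refine mapsTo_closedOrbit (fun a ha => ?_) (Submodule.starProjection_apply_mem _ η)
      have := mul_mul_mem_ran (one_mem D) (show a ∈ D from ha) hV
      rw [one_mul] at this
      exact apply_mem_closedOrbit this ξ
    simp [hQ, Submodule.starProjection_eq_self_iff.2 hm]
  have hran : ∀ V ∈ Ψ.ran, (1 - Q) * V * P ∈ Φ₂.ran := by
    rintro _ ⟨V, rfl⟩
    -- The part of `ran Ψ` outside `ran Φ₂` lies in `ran Φ₁` and is removed by the compression.
    have h3 : Ψ.map V = Φ₁.map (V - Φ₂.map V) + Φ₂.map V := by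
      rw [hΨ, map_sub]
      simp only [sub_apply, add_apply, mul_apply_eq_comp]
      abel
    change (1 - Q) * Ψ.map V * P ∈ Φ₂.ran
    rw [h3, mul_add, add_mul, hzero _ (Φ₁.map_mem_ran _), zero_add]
    exact mul_mul_mem_ran hQD hPD (Φ₂.map_mem_ran V)
  -- As `1 - Q` and `P` lie in `D`, the compression of `S` is the `Φ₂`-defect of the compressed `T`.
  have hcomp : (1 - Q) * S * P = (1 - Q) * T * P - Φ₂.map ((1 - Q) * T * P) := by
    rw [Φ₂.isSchurMultiplier.map_bimodule _ hQD _ hPD, hS, mul_sub, sub_mul]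
  have hSξ : S ξ - Q (S ξ) = ((1 - Q) * S * P) ξ := by simp [hPξ]
  calc ⨅ V : Φ₁.ran, ‖S ξ - (V : H →L[ℂ] H) ξ‖ ≤ ‖S ξ - Q (S ξ)‖ :=
        iInf_norm_sub_le_of_mem_closedOrbit (Submodule.starProjection_apply_mem _ _)
    _ ≤ ‖(1 - Q) * S * P‖ := by
        rw [hSξ]; simpa [hξ] using ((1 - Q) * S * P).le_opNorm ξ
    _ ≤ c₂ * arvesonDist ((1 - Q) * T * P) Φ₂.ran := by rw [hcomp]; exact h₂ _
    _ ≤ c₂ * arvesonDist T Ψ.ran := by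
        gcongr
        exact arvesonDist_mul_mul_le hQn hPn hran

end SchurIdempotent

end SchurHyper

/-! ### The sublattice and the bounds for its constants -/

open SchurHyper SchurHyper.SchurIdempotent in
theorem theorem3p7 {H : Type*} [NormedAddCommGroup H] [InnerProductSpace ℂ H] [CompleteSpace H]
    [TopologicalSpace.SeparableSpace H] (D : StarSubalgebra ℂ (H →L[ℂ] H))
    (hD : SchurHyper.IsMasa D) :
    (∀ Φ : SchurHyper.SchurIdempotent D,
      Φ ∈ SchurHyper.SchurIdempotent.estimateSet D ↔ SchurHyper.IsHyperreflexive Φ.ran) ∧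
    ∃ _B : BooleanAlgebra (SchurHyper.SchurIdempotent D),
      (∀ Φ Ψ : SchurHyper.SchurIdempotent D, Φ ≤ Ψ ↔ Φ.map * Ψ.map = Φ.map) ∧
      (∀ Φ Ψ : SchurHyper.SchurIdempotent D, (Φ ⊓ Ψ).map = Φ.map * Ψ.map) ∧
      (∀ Φ Ψ : SchurHyper.SchurIdempotent D,
        (Φ ⊔ Ψ).map = Φ.map + Ψ.map - Φ.map * Ψ.map) ∧
      (∀ Φ : SchurHyper.SchurIdempotent D, (Φᶜ).map = 1 - Φ.map) ∧
      (∃ L : Sublattice (SchurHyper.SchurIdempotent D),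
        (L : Set (SchurHyper.SchurIdempotent D)) = SchurHyper.SchurIdempotent.estimateSet D) ∧
      ∀ Φ₁ ∈ SchurHyper.SchurIdempotent.estimateSet D,
        ∀ Φ₂ ∈ SchurHyper.SchurIdempotent.estimateSet D,
          (Φ₁ ⊓ Φ₂).estimateConst ≤ Φ₁.estimateConst + Φ₂.estimateConst * ‖Φ₁.map‖ ∧
          (Φ₁ ⊔ Φ₂).estimateConst ≤ Φ₁.estimateConst * Φ₂.estimateConst := by
  let B := booleanAlgebra hD
  have hinf : ∀ Φ₁ ∈ estimateSet D, ∀ Φ₂ ∈ estimateSet D,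
      (Φ₁ ⊓ Φ₂).Estimate (Φ₁.estimateConst + Φ₂.estimateConst * ‖Φ₁.map‖) :=
    fun Φ₁ h₁ Φ₂ h₂ => by
      obtain ⟨⟨hc₁, he₁⟩, -⟩ := isLeast_estimateConst h₁
      obtain ⟨⟨hc₂, he₂⟩, -⟩ := isLeast_estimateConst h₂
      exact he₁.mul rfl (map_mul_comm hD Φ₁ Φ₂) hc₁ hc₂ he₂
  have hsup : ∀ Φ₁ ∈ estimateSet D, ∀ Φ₂ ∈ estimateSet D,
      (Φ₁ ⊔ Φ₂).Estimate (Φ₁.estimateConst * Φ₂.estimateConst) := fun Φ₁ h₁ Φ₂ h₂ => by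
    obtain ⟨⟨hc₁, he₁⟩, -⟩ := isLeast_estimateConst h₁
    obtain ⟨⟨hc₂, he₂⟩, -⟩ := isLeast_estimateConst h₂
    exact he₁.sup hD rfl hc₁ hc₂ he₂
  have hnonneg : ∀ Φ ∈ estimateSet D, 0 ≤ Φ.estimateConst := fun Φ h =>
    (isLeast_estimateConst h).1.1
  have hinf₀ : ∀ Φ₁ ∈ estimateSet D, ∀ Φ₂ ∈ estimateSet D,
      0 ≤ Φ₁.estimateConst + Φ₂.estimateConst * ‖Φ₁.map‖ := fun Φ₁ h₁ Φ₂ h₂ =>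
    add_nonneg (hnonneg _ h₁) (mul_nonneg (hnonneg _ h₂) (norm_nonneg _))
  have hsup₀ : ∀ Φ₁ ∈ estimateSet D, ∀ Φ₂ ∈ estimateSet D,
      0 ≤ Φ₁.estimateConst * Φ₂.estimateConst := fun Φ₁ h₁ Φ₂ h₂ =>
    mul_nonneg (hnonneg _ h₁) (hnonneg _ h₂)
  refine ⟨mem_estimateSet_iff, B, fun _ _ => Iff.rfl, fun _ _ => rfl, fun _ _ => rfl,
    fun _ => rfl, ⟨⟨estimateSet D, ?_, ?_⟩, rfl⟩, fun Φ₁ h₁ Φ₂ h₂ => ⟨?_, ?_⟩⟩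
  · exact fun Φ₁ h₁ Φ₂ h₂ => mem_estimateSet_of_nonneg (hsup₀ _ h₁ _ h₂) (hsup _ h₁ _ h₂)
  · exact fun Φ₁ h₁ Φ₂ h₂ => mem_estimateSet_of_nonneg (hinf₀ _ h₁ _ h₂) (hinf _ h₁ _ h₂)
  · exact estimateConst_le (hinf₀ _ h₁ _ h₂) (hinf _ h₁ _ h₂)
  · exact estimateConst_le (hsup₀ _ h₁ _ h₂) (hsup _ h₁ _ h₂)
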